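/- For a positive integer $N$ write $[N]=\{1,2,\dots,N\}$. For a positive integer $M$, a set $B$ of positive integers is called \emph{$M$-homogeneous} if $B\cap\{q,2q,\dots,Mq\}\neq\emptyset$ for every positive integer $q$. \textbf{(1) Supersaturated homogeneous Sárközy theorem.} For every real $\delta>0$ and every positive integer $M$ there exist a positive integer $N_0$ and a real $c_0>0$ such that for every integer $N\ge N_0$ the following holds. If $A\subset[N]$ satisfies $|A|\ge\delta N$ and $B$ is an $M$-homogeneous set of positive integers, then there are at least $c_0N^{5/2}$ tuples $(x,y)=((x_1,x_2),(y_1,y_2,y_3))\in A^2\times B^3$ satisfying $$x_1-x_2=y_1^2+y_2^2+y_3^2.$$ \textbf{(2) Multidimensional version.} For every real $\delta>0$ and all positive integers $d,M$ there exist a positive integer $N_0$ and a real $c_0>0$ such that for every integer $N\ge N_0$ the following holds. If $A\subset[N]^d$ satisfies $|A|\ge\delta N^d$ and $B_1,\dots,B_d$ are $M$-homogeneous sets of positive integers, then there are at least $c_0N^{3d/2}$ tuples $(x,x',y)\in A^2\times B_1\times\dots\times B_d$ satisfying $$x-x'=(y_1^2,\dots,y_d^2).$$ -/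

import Mathlib

/-- The discrete interval `[N] = {1, 2, …, N}`. -/
def interval (N : ℕ) : Finset ℕ := Finset.Icc 1 N

/-- The grid `[N]^d = {1, …, N}^d`. -/
def grid (d N : ℕ) : Finset (Fin d → ℕ) := Fintype.piFinset fun _ => interval N

/-- `B` is an `M`-homogeneous set of positive integers: every homogeneous progression
`q · [M] = {q, 2q, …, Mq}` with `q ≥ 1` meets `B`. -/
def IsHomogeneousSet (M : ℕ) (B : Set ℕ) : Prop :=
  (∀ b ∈ B, 0 < b) ∧
    ∀ q : ℕ, 0 < q → (B ∩ (fun m : ℕ => q * m) '' (interval M : Set ℕ)).Nonempty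

/-- The tuples `(x, y) ∈ A² × B³` with `x₁ - x₂ = y₁² + y₂² + y₃²` (indices are shifted to
start at `0`, and the equation is read in `ℤ`). -/
def sarkozySolutions (A : Finset ℕ) (B : Set ℕ) : Set ((Fin 2 → ℕ) × (Fin 3 → ℕ)) :=
  {p | (∀ i, p.1 i ∈ A) ∧ (∀ j, p.2 j ∈ B) ∧
    (p.1 0 : ℤ) - (p.1 1 : ℤ) = (p.2 0 : ℤ) ^ 2 + (p.2 1 : ℤ) ^ 2 + (p.2 2 : ℤ) ^ 2}

/-- The tuples `(x, x', y) ∈ A² × B₁ × ⋯ × B_d`, where `A ⊆ ℕ^d`, with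
`x - x' = (y₁², …, y_d²)` (read in `ℤ^d`). -/
def multiSarkozySolutions {d : ℕ} (A : Finset (Fin d → ℕ)) (B : Fin d → Set ℕ) :
    Set ((Fin d → ℕ) × (Fin d → ℕ) × (Fin d → ℕ)) :=
  {p | p.1 ∈ A ∧ p.2.1 ∈ A ∧ (∀ i, p.2.2 i ∈ B i) ∧
    ∀ i, (p.1 i : ℤ) - (p.2.1 i : ℤ) = (p.2.2 i : ℤ) ^ 2}

/-- The solution set is finite, so that its `Set.ncard` is its true number of elements. -/
theorem sarkozySolutions_finite (A : Finset ℕ) (B : Set ℕ) :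
    (sarkozySolutions A B).Finite := by
  classical
  refine ((Fintype.piFinset fun _ : Fin 2 => A) ×ˢ
    (Fintype.piFinset fun _ : Fin 3 => Finset.range (A.sup id + 1))).finite_toSet.subset ?_
  rintro ⟨x, y⟩ ⟨hx, -, h⟩
  dsimp only at hx h
  have h0 : x 0 ≤ A.sup id := Finset.le_sup (f := id) (hx 0)
  have e : x 0 = x 1 + (y 0 ^ 2 + y 1 ^ 2 + y 2 ^ 2) := by zify; linarith
  have k0 : y 0 ≤ y 0 ^ 2 := Nat.le_self_pow two_ne_zero _
  have k1 : y 1 ≤ y 1 ^ 2 := Nat.le_self_pow two_ne_zero _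
  have k2 : y 2 ≤ y 2 ^ 2 := Nat.le_self_pow two_ne_zero _
  simp only [Finset.coe_product, Set.mem_prod, Finset.mem_coe, Fintype.mem_piFinset,
    Finset.mem_range]
  refine ⟨hx, fun j => ?_⟩
  fin_cases j <;> simp <;> omega

/-- The solution set is finite, so that its `Set.ncard` is its true number of elements. -/
theorem multiSarkozySolutions_finite {d : ℕ} (A : Finset (Fin d → ℕ)) (B : Fin d → Set ℕ) :
    (multiSarkozySolutions A B).Finite := by
  refine Set.Finite.of_finite_image (f := fun p => (p.1, p.2.1))
    ((A ×ˢ A).finite_toSet.subset ?_) ?_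
  · rintro _ ⟨⟨x, x', y⟩, ⟨hx, hx', -⟩, rfl⟩
    exact Finset.mem_coe.2 (Finset.mem_product.2 ⟨hx, hx'⟩)
  · rintro ⟨x, x', y⟩ ⟨-, -, -, h⟩ ⟨z, z', w⟩ ⟨-, -, -, k⟩ e
    simp only [Prod.mk.injEq] at e
    obtain ⟨rfl, rfl⟩ := e
    have : y = w := by
      funext i
      have e2 : (y i : ℤ) ^ 2 = (w i : ℤ) ^ 2 := (h i).symm.trans (k i)
      have e3 : y i ^ 2 = w i ^ 2 := by exact_mod_cast e2
      exact Nat.pow_left_injective two_ne_zero e3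
    rw [this]

/-! The base is Sárközy's theorem, `exists_not_squareDifferenceFree`, proved without Fourier
analysis. Let `d` be the infimal density bound for square-difference-free sets over all lengths, and
suppose `d > 0`. A nearly extremal set has density almost `d`, yet cannot be much denser than `d` on
progressions of square step, so its balanced function has small averages along them. Van der
Corput's inequality passes this to shifts by squares (`sum_abs_average_squares_le`), and the set
then has too many square differences.

Applied to a line in a power of `A`, Sárközy's theorem gives one `q` for which all the differences
`q² (m₁², …, m_d²)`, with every `m_i ≤ M`, occur in `A` (`exists_simultaneous_square_differences`).
Not knowing which `m_i` homogeneity will supply is then harmless.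

For the count, copies of `[N₁]^d` stretched by `r_i²` in direction `i` are placed at all positions.
A positive proportion of them meet `A` densely and yield a solution with `y_i = q r_i m_i`; each
solution arises boundedly often. With about `N^d` positions and `N^(d/2)` stretches this gives part
(2). Part (1) is the case `d = 3` for the preimage of `A` under the coordinate sum, where each
solution lifts at most `N²` times. -/

/-! ### Van der Corput's method on cyclic groups -/

theorem abs_sum_range_sub_shift_le (v : ℕ → ℝ) (hv : ∀ i, |v i| ≤ 1) (Q h : ℕ) :
    |∑ q ∈ Finset.range Q, v q - ∑ q ∈ Finset.range Q, v (q + h)| ≤ 2 * h := by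
  induction h with
  | zero => simp
  | succ h ih =>
    have e : ∑ q ∈ Finset.range Q, v (q + h) - ∑ q ∈ Finset.range Q, v (q + (h + 1))
        = v h - v (Q + h) := by
      have h1 := Finset.sum_range_succ (fun q => v (q + h)) Q
      have h2 := Finset.sum_range_succ' (fun q => v (q + h)) Q
      simp only [zero_add, add_assoc, add_comm 1 h] at h1 h2
      linarith
    have h1 := abs_le.1 (hv h)
    have h2 := abs_le.1 (hv (Q + h))
    rw [abs_le] at ih ⊢
    push_cast
    constructor <;> linarith [ih.1, ih.2]

theorem abs_sum_range_sub_average_le (v : ℕ → ℝ) (hv : ∀ i, |v i| ≤ 1) (Q a : ℕ) {H : ℕ}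
    (hH : 0 < H) :
    |∑ q ∈ Finset.range Q, v q -
      (∑ h ∈ Finset.range H, ∑ q ∈ Finset.range Q, v (q + a * h)) / H| ≤ 2 * a * H := by
  have hH' : (0 : ℝ) < H := by exact_mod_cast hH
  have e : ∑ q ∈ Finset.range Q, v q -
      (∑ h ∈ Finset.range H, ∑ q ∈ Finset.range Q, v (q + a * h)) / H =
      (∑ h ∈ Finset.range H, (∑ q ∈ Finset.range Q, v q -
        ∑ q ∈ Finset.range Q, v (q + a * h))) / H := by
    rw [Finset.sum_sub_distrib]
    simp only [Finset.sum_const, Finset.card_range, nsmul_eq_mul]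
    field_simp
  rw [e, abs_div, abs_of_pos hH', div_le_iff₀ hH']
  refine (Finset.abs_sum_le_sum_abs _ _).trans ?_
  refine (Finset.sum_le_card_nsmul _ _ (2 * a * H : ℝ) fun h hh => ?_).trans
    (by simp [mul_comm])
  refine (abs_sum_range_sub_shift_le v hv Q (a * h)).trans ?_
  have : (h : ℝ) ≤ H := by exact_mod_cast (Finset.mem_range.1 hh).le
  push_cast
  have := mul_le_mul_of_nonneg_left this (by positivity : (0 : ℝ) ≤ 2 * a)
  linarith

section Cyclic

variable {n : ℕ} [NeZero n]

theorem sum_add_right_zmod (φ : ZMod n → ℝ) (c : ZMod n) : ∑ x, φ (x + c) = ∑ x, φ x :=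
  Equiv.sum_comp (Equiv.addRight c) φ

/-- Averages along a progression of step `k` are controlled by those of step `k ^ 2`. -/
theorem sum_abs_progression_le (f : ZMod n → ℝ) (hf : ∀ x, |f x| ≤ 1) (k Q : ℕ) {L : ℕ}
    (hL : 0 < L) :
    ∑ x, |∑ q ∈ Finset.range Q, f (x + (k * q : ℕ))| ≤
      2 * k * L * n + Q * ∑ x, |(∑ l ∈ Finset.range L, f (x + (k ^ 2 * l : ℕ))) / L| := by
  have key : ∀ x : ZMod n, |∑ q ∈ Finset.range Q, f (x + (k * q : ℕ))| ≤ 2 * k * L +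
      ∑ q ∈ Finset.range Q,
        |(∑ l ∈ Finset.range L, f (x + (k * q : ℕ) + (k ^ 2 * l : ℕ))) / L| := by
    intro x
    -- Moving `q` by multiples of `k` moves `k * q` by multiples of `k ^ 2`.
    have h1 := abs_sum_range_sub_average_le (fun q => f (x + (k * q : ℕ))) (fun _ => hf _) Q k hL
    have h2 : |(∑ h ∈ Finset.range L, ∑ q ∈ Finset.range Q,
        f (x + (k * (q + k * h) : ℕ))) / L| ≤ ∑ q ∈ Finset.range Q,
        |(∑ l ∈ Finset.range L, f (x + (k * q : ℕ) + (k ^ 2 * l : ℕ))) / L| := by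
      rw [Finset.sum_comm, Finset.sum_div]
      refine (Finset.abs_sum_le_sum_abs _ _).trans (le_of_eq ?_)
      refine Finset.sum_congr rfl fun q _ => ?_
      congr 2
      refine Finset.sum_congr rfl fun l _ => ?_
      congr 1
      push_cast
      ring
    have h3 := abs_sub_abs_le_abs_sub (∑ q ∈ Finset.range Q, f (x + (k * q : ℕ)))
      ((∑ h ∈ Finset.range L, ∑ q ∈ Finset.range Q, f (x + (k * (q + k * h) : ℕ))) / L)
    linarith
  refine (Finset.sum_le_sum fun x _ => key x).trans ?_
  rw [Finset.sum_add_distrib, Finset.sum_comm]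
  have h4 : ∀ q ∈ Finset.range Q, ∑ x : ZMod n,
      |(∑ l ∈ Finset.range L, f (x + (k * q : ℕ) + (k ^ 2 * l : ℕ))) / L| =
      ∑ x : ZMod n, |(∑ l ∈ Finset.range L, f (x + (k ^ 2 * l : ℕ))) / L| := fun q _ =>
    sum_add_right_zmod (fun x : ZMod n => |(∑ l ∈ Finset.range L, f (x + (k ^ 2 * l : ℕ))) / L|) _
  rw [Finset.sum_congr rfl h4]
  simp [mul_comm]

/-- After translating `x`, only the difference of the two squares matters, and `(q + h + t)² - (q +
h)² = t(2h + t) + 2tq` is linear in `q`. -/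
theorem abs_sum_square_correlation_le (f : ZMod n → ℝ) (hf : ∀ x, |f x| ≤ 1) (Q h t : ℕ) :
    |∑ q ∈ Finset.range Q, ∑ x, f (x + ((q + h) ^ 2 : ℕ)) * f (x + ((q + (h + t)) ^ 2 : ℕ))| ≤
      ∑ x, |∑ q ∈ Finset.range Q, f (x + (2 * t * q : ℕ))| := by
  have h1 : ∀ q ∈ Finset.range Q,
      ∑ x : ZMod n, f (x + ((q + h) ^ 2 : ℕ)) * f (x + ((q + (h + t)) ^ 2 : ℕ)) =
      ∑ x : ZMod n, f x * f (x + (t * (2 * h + t) : ℕ) + (2 * t * q : ℕ)) := by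
    intro q _
    rw [← sum_add_right_zmod (fun x : ZMod n => f x * f (x + (t * (2 * h + t) : ℕ) + (2 * t * q : ℕ)))
      (((q + h) ^ 2 : ℕ) : ZMod n)]
    refine Finset.sum_congr rfl fun x _ => ?_
    congr 2
    push_cast
    ring
  rw [Finset.sum_congr rfl h1, Finset.sum_comm,
    ← sum_add_right_zmod (fun x : ZMod n => |∑ q ∈ Finset.range Q, f (x + (2 * t * q : ℕ))|)
      ((t * (2 * h + t) : ℕ) : ZMod n)]
  refine (Finset.abs_sum_le_sum_abs _ _).trans (Finset.sum_le_sum fun x _ => ?_)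
  rw [← Finset.mul_sum, abs_mul]
  exact mul_le_of_le_one_left (abs_nonneg _) (hf x)

/-- Van der Corput's inequality for averages over the squares. -/
theorem sum_sq_average_squares_le (f : ZMod n → ℝ) (hf : ∀ x, |f x| ≤ 1) (Q H : ℕ) {D : ℝ}
    (hD0 : 0 ≤ D)
    (hD : ∀ t, 0 < t → t < H → ∑ x, |∑ q ∈ Finset.range Q, f (x + (2 * t * q : ℕ))| ≤ D) :
    ∑ x, (∑ h ∈ Finset.range H, ∑ q ∈ Finset.range Q, f (x + ((q + h) ^ 2 : ℕ))) ^ 2 ≤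
      Q * (H * (Q * n) + H ^ 2 * D) := by
  -- Expanding the square gives `H` diagonal pairs, bounded trivially, and off-diagonal pairs, each
  -- at most `D` by linearization.
  have pair : ∀ h ∈ Finset.range H, ∀ h' ∈ Finset.range H,
      ∑ q ∈ Finset.range Q, ∑ x : ZMod n,
        f (x + ((q + h) ^ 2 : ℕ)) * f (x + ((q + h') ^ 2 : ℕ)) ≤
        (if h = h' then (Q * n : ℝ) else 0) + D := by
    intro h hh h' hh'
    rw [Finset.mem_range] at hh hh'
    rcases lt_trichotomy h h' with hlt | rfl | hlt
    · obtain ⟨t, rfl⟩ := Nat.exists_eq_add_of_lt hlt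
      rw [if_neg (by omega), zero_add]
      exact (le_abs_self _).trans ((abs_sum_square_correlation_le f hf Q h (t + 1)).trans
        (hD _ (by omega) (by omega)))
    · rw [if_pos rfl]
      have : ∑ q ∈ Finset.range Q, ∑ x : ZMod n,
          f (x + ((q + h) ^ 2 : ℕ)) * f (x + ((q + h) ^ 2 : ℕ)) ≤
          ∑ q ∈ Finset.range Q, ∑ x : ZMod n, (1 : ℝ) := by
        refine Finset.sum_le_sum fun q _ => Finset.sum_le_sum fun x _ => ?_
        rw [← abs_mul_abs_self]
        exact mul_le_one₀ (hf _) (abs_nonneg _) (hf _)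
      simp only [Finset.sum_const, Finset.card_univ, ZMod.card, Finset.card_range,
        nsmul_eq_mul, mul_one] at this
      linarith
    · obtain ⟨t, rfl⟩ := Nat.exists_eq_add_of_lt hlt
      rw [if_neg (by omega), zero_add]
      refine (le_abs_self _).trans (le_trans (le_of_eq ?_)
        ((abs_sum_square_correlation_le f hf Q h' (t + 1)).trans (hD _ (by omega) (by omega))))
      simp only [mul_comm, add_assoc]
  have cs : ∀ x : ZMod n,
      (∑ h ∈ Finset.range H, ∑ q ∈ Finset.range Q, f (x + ((q + h) ^ 2 : ℕ))) ^ 2 ≤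
      Q * ∑ q ∈ Finset.range Q, (∑ h ∈ Finset.range H, f (x + ((q + h) ^ 2 : ℕ))) ^ 2 := by
    intro x
    rw [Finset.sum_comm]
    have := sq_sum_le_card_mul_sum_sq (s := Finset.range Q)
      (f := fun q => ∑ h ∈ Finset.range H, f (x + ((q + h) ^ 2 : ℕ)))
    rwa [Finset.card_range] at this
  refine (Finset.sum_le_sum fun x _ => cs x).trans ?_
  rw [← Finset.mul_sum]
  refine mul_le_mul_of_nonneg_left ?_ (Nat.cast_nonneg Q)
  have e : ∑ x : ZMod n, ∑ q ∈ Finset.range Q,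
      (∑ h ∈ Finset.range H, f (x + ((q + h) ^ 2 : ℕ))) ^ 2 =
      ∑ h ∈ Finset.range H, ∑ h' ∈ Finset.range H, ∑ q ∈ Finset.range Q, ∑ x : ZMod n,
        f (x + ((q + h) ^ 2 : ℕ)) * f (x + ((q + h') ^ 2 : ℕ)) := by
    calc _ = ∑ x : ZMod n, ∑ q ∈ Finset.range Q, ∑ h ∈ Finset.range H, ∑ h' ∈ Finset.range H,
          f (x + ((q + h) ^ 2 : ℕ)) * f (x + ((q + h') ^ 2 : ℕ)) := by
            refine Finset.sum_congr rfl fun x _ => Finset.sum_congr rfl fun q _ => ?_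
            rw [sq, Finset.sum_mul_sum]
      _ = ∑ q ∈ Finset.range Q, ∑ h ∈ Finset.range H, ∑ h' ∈ Finset.range H,
          ∑ x : ZMod n, f (x + ((q + h) ^ 2 : ℕ)) * f (x + ((q + h') ^ 2 : ℕ)) := by
            rw [Finset.sum_comm]
            refine Finset.sum_congr rfl fun q _ => ?_
            rw [Finset.sum_comm]
            refine Finset.sum_congr rfl fun h _ => ?_
            rw [Finset.sum_comm]
      _ = _ := by
            rw [Finset.sum_comm]
            refine Finset.sum_congr rfl fun h _ => ?_
            rw [Finset.sum_comm]
  rw [e]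
  refine (Finset.sum_le_sum fun h hh => Finset.sum_le_sum fun h' hh' => pair h hh h' hh').trans ?_
  simp only [Finset.sum_add_distrib, Finset.sum_ite_eq, Finset.sum_const, Finset.card_range,
    nsmul_eq_mul]
  rw [Finset.sum_congr rfl (fun h hh => if_pos hh)]
  simp only [Finset.sum_const, Finset.card_range, nsmul_eq_mul]
  apply le_of_eq
  ring

/-- If `f` has small averages along progressions of step `k ^ 2`, then it has small averages
along shifts by squares. -/
theorem sum_abs_average_squares_le (f : ZMod n → ℝ) (hf : ∀ x, |f x| ≤ 1) (Q : ℕ) {H L : ℕ}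
    (hH : 0 < H) (hL : 0 < L) {W : ℝ} (hW0 : 0 ≤ W)
    (hW : ∀ k, 0 < k → k ≤ 2 * H →
      ∑ x, |(∑ l ∈ Finset.range L, f (x + (k ^ 2 * l : ℕ))) / L| ≤ W) :
    ∑ x, |∑ q ∈ Finset.range Q, f (x + (q ^ 2 : ℕ))| ≤ 2 * H * n +
      √(n * (Q * ((Q * n) / H + (4 * H * L * n + Q * W)))) := by
  have hH' : (0 : ℝ) < H := by exact_mod_cast hH
  set c : ZMod n → ℝ := fun x =>
    ∑ h ∈ Finset.range H, ∑ q ∈ Finset.range Q, f (x + ((q + h) ^ 2 : ℕ)) with hc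
  have h1 : ∑ x, |∑ q ∈ Finset.range Q, f (x + (q ^ 2 : ℕ))| ≤ 2 * H * n + ∑ x, |c x| / H := by
    have : ∀ x : ZMod n, |∑ q ∈ Finset.range Q, f (x + (q ^ 2 : ℕ))| ≤ 2 * H + |c x| / H := by
      intro x
      have h1 := abs_sum_range_sub_average_le (fun q => f (x + (q ^ 2 : ℕ))) (fun _ => hf _) Q 1 hH
      have h3 := abs_sub_abs_le_abs_sub (∑ q ∈ Finset.range Q, f (x + (q ^ 2 : ℕ))) (c x / H)
      simp only [one_mul, Nat.cast_one, mul_one] at h1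
      rw [abs_div, abs_of_pos hH'] at h3
      linarith
    refine (Finset.sum_le_sum fun x _ => this x).trans ?_
    rw [Finset.sum_add_distrib]
    simp [mul_comm]
  refine h1.trans (add_le_add_right (Real.le_sqrt_of_sq_le ?_) _)
  have h2 := sum_sq_average_squares_le f hf Q H (D := 4 * H * L * n + Q * W) (by positivity) (by
    intro t ht htH
    refine (sum_abs_progression_le f hf (2 * t) Q hL).trans ?_
    have h5 : (t : ℝ) ≤ H := by exact_mod_cast htH.le
    have h6 := mul_le_mul_of_nonneg_right h5 (by positivity : (0 : ℝ) ≤ 4 * L * n)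
    have h7 := mul_le_mul_of_nonneg_left (hW (2 * t) (by omega) (by omega))
      (Nat.cast_nonneg (α := ℝ) Q)
    push_cast at h7 ⊢
    linarith)
  have h3 : (∑ x, |c x|) ^ 2 ≤ n * ∑ x, c x ^ 2 := by
    have := sq_sum_le_card_mul_sum_sq (s := (Finset.univ : Finset (ZMod n))) (f := fun x => |c x|)
    simpa [ZMod.card] using this
  rw [← Finset.sum_div, div_pow, div_le_iff₀ (by positivity)]
  refine h3.trans ?_
  rw [mul_assoc]
  refine mul_le_mul_of_nonneg_left (h2.trans (le_of_eq ?_)) (Nat.cast_nonneg n)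
  field_simp

end Cyclic

/-! ### Sárközy's theorem by near-extremality -/

/-- No two elements of `A` differ by a positive square. -/
def SquareDifferenceFree (A : Finset ℕ) : Prop :=
  ∀ a ∈ A, ∀ q : ℕ, 0 < q → a + q ^ 2 ∉ A

/-- The indicator function of `A ⊆ {0, …, n - 1}` as a function on `ZMod n`. -/
def cyclicIndicator (n : ℕ) (A : Finset ℕ) (x : ZMod n) : ℝ := if x.val ∈ A then 1 else 0

theorem cyclicIndicator_nonneg {n : ℕ} (A : Finset ℕ) (x : ZMod n) : 0 ≤ cyclicIndicator n A x := by
  unfold cyclicIndicator; split_ifs <;> norm_num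

theorem cyclicIndicator_le_one {n : ℕ} (A : Finset ℕ) (x : ZMod n) : cyclicIndicator n A x ≤ 1 := by
  unfold cyclicIndicator; split_ifs <;> norm_num

section Cyclic

variable {n : ℕ} [NeZero n]

theorem zmod_add_natCast_val {x : ZMod n} {m : ℕ} (h : x.val + m < n) :
    (x + (m : ZMod n)).val = x.val + m := by
  have : x + (m : ZMod n) = ((x.val + m : ℕ) : ZMod n) := by
    rw [Nat.cast_add, ZMod.natCast_zmod_val]
  rw [this, ZMod.val_cast_of_lt h]

theorem card_filter_lt_val_add_le (m : ℕ) :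
    (Finset.univ.filter fun x : ZMod n => n < x.val + m).card ≤ m := by
  have h : ((Finset.univ.filter fun x : ZMod n => n < x.val + m).image ZMod.val).card =
      (Finset.univ.filter fun x : ZMod n => n < x.val + m).card :=
    Finset.card_image_of_injective _ (ZMod.val_injective n)
  rw [← h]
  have hsub : (Finset.univ.filter fun x : ZMod n => n < x.val + m).image ZMod.val ⊆
      Finset.Ico (n + 1 - m) n := by
    intro y hy
    simp only [Finset.mem_image, Finset.mem_filter, Finset.mem_univ, true_and] at hy
    obtain ⟨x, hx, rfl⟩ := hy
    have := ZMod.val_lt x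
    rw [Finset.mem_Ico]
    omega
  refine (Finset.card_le_card hsub).trans ?_
  rw [Nat.card_Ico]
  omega

theorem sum_cyclicIndicator {A : Finset ℕ} (hA : A ⊆ Finset.range n) :
    ∑ x, cyclicIndicator n A x = A.card := by
  unfold cyclicIndicator
  rw [Finset.sum_boole]
  congr 1
  refine Finset.card_bij (fun x _ => x.val) (by simp) (fun x _ y _ h => ZMod.val_injective n h) ?_
  intro a ha
  have := ZMod.val_cast_of_lt (Finset.mem_range.1 (hA ha))
  exact ⟨(a : ZMod n), by simpa [this] using ha, this⟩

/-- Dilation by `k ^ 2` preserves squares, so the trace of `A` on such a progression is again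
square-difference-free; the hypothesis on `x` excludes wrap-around. -/
theorem SquareDifferenceFree.sum_indicator_progression_le {A : Finset ℕ}
    (hA : SquareDifferenceFree A) {L : ℕ} {s : ℝ}
    (hs : ∀ B ⊆ Finset.range L, SquareDifferenceFree B → (B.card : ℝ) ≤ s * L)
    {k : ℕ} (hk : 0 < k) {x : ZMod n} (hx : x.val + k ^ 2 * L ≤ n) :
    ∑ l ∈ Finset.range L, cyclicIndicator n A (x + (k ^ 2 * l : ℕ)) ≤ s * L := by
  have hB : SquareDifferenceFree ((Finset.range L).filter fun l => x.val + k ^ 2 * l ∈ A) := by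
    intro a ha q hq hb
    rw [Finset.mem_filter] at ha hb
    refine hA _ ha.2 (k * q) (by positivity) ?_
    have e : x.val + k ^ 2 * a + (k * q) ^ 2 = x.val + k ^ 2 * (a + q ^ 2) := by ring
    rw [e]
    exact hb.2
  refine le_trans (le_of_eq ?_) (hs _ (Finset.filter_subset _ _) hB)
  rw [← Finset.sum_boole]
  refine Finset.sum_congr rfl fun l hl => ?_
  have hl' : k ^ 2 * l < k ^ 2 * L :=
    Nat.mul_lt_mul_of_pos_left (Finset.mem_range.1 hl) (by positivity)
  unfold cyclicIndicator
  rw [zmod_add_natCast_val (by omega)]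

/-- A one-sided bound suffices: the averages have mean zero, so their `L¹` norm is twice that of
their positive part. This part is at most `ε`, except where the progression wraps around. -/
theorem SquareDifferenceFree.sum_abs_balanced_le {A : Finset ℕ} (hA : SquareDifferenceFree A)
    (hAn : A ⊆ Finset.range n) {L : ℕ} (hL : 0 < L) {ε : ℝ} (hε : 0 ≤ ε)
    (hs : ∀ B ⊆ Finset.range L, SquareDifferenceFree B →
      (B.card : ℝ) ≤ ((A.card : ℝ) / n + ε) * L)
    {k : ℕ} (hk : 0 < k) :
    ∑ x : ZMod n, |(∑ l ∈ Finset.range L,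
      (cyclicIndicator n A (x + (k ^ 2 * l : ℕ)) - (A.card : ℝ) / n)) / L| ≤
      2 * ε * n + 2 * (k ^ 2 * L) := by
  have hL' : (0 : ℝ) < L := by exact_mod_cast hL
  have hn : (0 : ℝ) < n := by exact_mod_cast Nat.pos_of_ne_zero (NeZero.ne n)
  set u : ZMod n → ℝ := fun x => (∑ l ∈ Finset.range L,
      (cyclicIndicator n A (x + (k ^ 2 * l : ℕ)) - (A.card : ℝ) / n)) / L with hu
  have hsum : ∑ x, u x = 0 := by
    rw [hu]
    simp only
    rw [← Finset.sum_div, Finset.sum_comm]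
    have : ∀ l ∈ Finset.range L, ∑ x : ZMod n,
        (cyclicIndicator n A (x + (k ^ 2 * l : ℕ)) - (A.card : ℝ) / n) = 0 := by
      intro l _
      rw [Finset.sum_sub_distrib, sum_add_right_zmod (cyclicIndicator n A),
        sum_cyclicIndicator hAn]
      simp only [Finset.sum_const, Finset.card_univ, ZMod.card, nsmul_eq_mul]
      field_simp
      ring
    rw [Finset.sum_congr rfl this]
    simp
  have hq : 0 ≤ (A.card : ℝ) / n := by positivity
  have hpos : ∀ x, max (u x) 0 ≤ ε + if n < x.val + k ^ 2 * L then 1 else 0 := by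
    intro x
    have hsplit : u x = (∑ l ∈ Finset.range L, cyclicIndicator n A (x + (k ^ 2 * l : ℕ))) / L -
        (A.card : ℝ) / n := by
      rw [hu]
      simp only [Finset.sum_sub_distrib, Finset.sum_const, Finset.card_range, nsmul_eq_mul]
      field_simp
    split_ifs with h
    · refine max_le ?_ (by linarith)
      have : (∑ l ∈ Finset.range L, cyclicIndicator n A (x + (k ^ 2 * l : ℕ))) / L ≤ 1 := by
        rw [div_le_one hL']
        refine (Finset.sum_le_card_nsmul _ _ 1 fun l _ => cyclicIndicator_le_one A _).trans ?_
        simp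
      linarith
    · refine max_le ?_ (by linarith)
      have := hA.sum_indicator_progression_le hs hk (x := x) (by omega)
      rw [← div_le_iff₀ hL'] at this
      linarith
  have habs : ∀ x, |u x| = 2 * max (u x) 0 - u x := by
    intro x
    rcases le_total 0 (u x) with h | h
    · rw [abs_of_nonneg h, max_eq_left h]; ring
    · rw [abs_of_nonpos h, max_eq_right h]; ring
  calc ∑ x, |u x| = 2 * ∑ x, max (u x) 0 := by
        rw [Finset.sum_congr rfl fun x _ => habs x, Finset.sum_sub_distrib, hsum, Finset.mul_sum]
        ring
    _ ≤ 2 * ∑ x : ZMod n, (ε + if n < x.val + k ^ 2 * L then 1 else 0) := by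
        have := Finset.sum_le_sum fun x (_ : x ∈ Finset.univ) => hpos x
        linarith
    _ ≤ 2 * (n * ε + (k ^ 2 * L : ℕ)) := by
        rw [Finset.sum_add_distrib, Finset.sum_boole]
        simp only [Finset.sum_const, Finset.card_univ, ZMod.card, nsmul_eq_mul]
        have : ((Finset.univ.filter fun x : ZMod n => n < x.val + k ^ 2 * L).card : ℝ) ≤
            (k ^ 2 * L : ℕ) := by exact_mod_cast card_filter_lt_val_add_le _
        linarith
    _ = _ := by push_cast; ring

theorem SquareDifferenceFree.sum_correlation_le {A : Finset ℕ} (hA : SquareDifferenceFree A)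
    (Q : ℕ) :
    ∑ q ∈ Finset.range Q, ∑ x : ZMod n,
      cyclicIndicator n A x * cyclicIndicator n A (x + (q ^ 2 : ℕ)) ≤ n + Q * (Q ^ 2 + 1) := by
  rcases Nat.eq_zero_or_pos Q with rfl | hQ
  · simp
  have h1 : ∀ q ∈ Finset.range Q, ∑ x : ZMod n,
      cyclicIndicator n A x * cyclicIndicator n A (x + (q ^ 2 : ℕ)) ≤
      (if q = 0 then (n : ℝ) else 0) + (Q ^ 2 + 1) := by
    intro q hq
    rw [Finset.mem_range] at hq
    split_ifs with h0
    · have : ∑ x : ZMod n, cyclicIndicator n A x * cyclicIndicator n A (x + (q ^ 2 : ℕ)) ≤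
          ∑ x : ZMod n, (1 : ℝ) := Finset.sum_le_sum fun x _ =>
        mul_le_one₀ (cyclicIndicator_le_one A _) (cyclicIndicator_nonneg A _)
          (cyclicIndicator_le_one A _)
      simp only [Finset.sum_const, Finset.card_univ, ZMod.card, nsmul_eq_mul, mul_one] at this
      have : (0 : ℝ) ≤ (Q : ℝ) ^ 2 + 1 := by positivity
      linarith
    · have h2 : ∀ x : ZMod n, cyclicIndicator n A x * cyclicIndicator n A (x + (q ^ 2 : ℕ)) ≤
          -- Only a shift that wraps around can contribute; the `+ 1` makes `x.val + q ^ 2 < n`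
          -- strict in the other case.
          if n < x.val + (q ^ 2 + 1) then 1 else 0 := by
        intro x
        split_ifs with h
        · exact mul_le_one₀ (cyclicIndicator_le_one A _) (cyclicIndicator_nonneg A _)
            (cyclicIndicator_le_one A _)
        · apply le_of_eq
          unfold cyclicIndicator
          rw [zmod_add_natCast_val (by omega)]
          by_cases hx : x.val ∈ A
          · rw [if_neg (hA _ hx q (Nat.pos_of_ne_zero h0)), mul_zero]
          · rw [if_neg hx, zero_mul]
      refine (Finset.sum_le_sum fun x _ => h2 x).trans ?_
      rw [Finset.sum_boole, zero_add]
      have h3 := card_filter_lt_val_add_le (n := n) (q ^ 2 + 1)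
      have h4 : q ^ 2 ≤ Q ^ 2 := Nat.pow_le_pow_left hq.le 2
      exact_mod_cast h3.trans (by omega)
  refine (Finset.sum_le_sum h1).trans ?_
  rw [Finset.sum_add_distrib, Finset.sum_ite_eq' (Finset.range Q) 0 (fun _ => (n : ℝ)),
    if_pos (Finset.mem_range.2 hQ)]
  simp [mul_add]

/-- The correlations of `A` with its square shifts are few by hypothesis, but equal the random count
`Q n α²` up to an error controlled by the balanced function. -/
theorem SquareDifferenceFree.density_le {A : Finset ℕ} (hA : SquareDifferenceFree A)
    (hAn : A ⊆ Finset.range n) (Q : ℕ) {H L : ℕ} (hH : 0 < H) (hL : 0 < L) {ε : ℝ} (hε : 0 ≤ ε)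
    (hs : ∀ B ⊆ Finset.range L, SquareDifferenceFree B →
      (B.card : ℝ) ≤ ((A.card : ℝ) / n + ε) * L) :
    Q * n * ((A.card : ℝ) / n) ^ 2 ≤ n + Q * (Q ^ 2 + 1) + (2 * H * n +
      √(n * (Q * ((Q * n) / H + (4 * H * L * n + Q * (2 * ε * n + 8 * H ^ 2 * L)))))) := by
  have hn : (0 : ℝ) < n := by exact_mod_cast Nat.pos_of_ne_zero (NeZero.ne n)
  set α : ℝ := (A.card : ℝ) / n with hα
  have hα0 : 0 ≤ α := by positivity
  have hα1 : α ≤ 1 := by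
    rw [hα, div_le_one hn]
    exact_mod_cast (Finset.card_le_card hAn).trans (by simp)
  have hf : ∀ x, |cyclicIndicator n A x - α| ≤ 1 := fun x => abs_le.2
    ⟨by linarith [cyclicIndicator_nonneg A x], by linarith [cyclicIndicator_le_one A x]⟩
  have h1 := sum_abs_average_squares_le (fun x => cyclicIndicator n A x - α) hf Q hH hL
    (W := 2 * ε * n + 8 * H ^ 2 * L) (by positivity) (by
      intro k hk hkH
      refine (hA.sum_abs_balanced_le hAn hL hε hs hk).trans ?_
      have h2 : (k : ℝ) ≤ 2 * H := by exact_mod_cast hkH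
      have h3 : (k : ℝ) ^ 2 ≤ (2 * H) ^ 2 := pow_le_pow_left₀ (Nat.cast_nonneg k) h2 2
      have h4 := mul_le_mul_of_nonneg_right h3 (Nat.cast_nonneg (α := ℝ) L)
      linarith)
  have h2 := hA.sum_correlation_le (n := n) Q
  have hmean : ∀ c : ZMod n, ∑ x, cyclicIndicator n A (x + c) = α * n := by
    intro c
    rw [sum_add_right_zmod (cyclicIndicator n A), sum_cyclicIndicator hAn, hα]
    field_simp
  have h3 : ∑ q ∈ Finset.range Q, ∑ x : ZMod n,
      cyclicIndicator n A x * cyclicIndicator n A (x + (q ^ 2 : ℕ)) = Q * n * α ^ 2 +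
      ∑ x : ZMod n, (cyclicIndicator n A x - α) *
        ∑ q ∈ Finset.range Q, (cyclicIndicator n A (x + (q ^ 2 : ℕ)) - α) := by
    simp only [Finset.mul_sum]
    rw [Finset.sum_comm (s := (Finset.univ : Finset (ZMod n)))]
    have : ∀ q ∈ Finset.range Q, ∑ x : ZMod n,
        cyclicIndicator n A x * cyclicIndicator n A (x + (q ^ 2 : ℕ)) =
        n * α ^ 2 + ∑ x : ZMod n, (cyclicIndicator n A x - α) *
          (cyclicIndicator n A (x + (q ^ 2 : ℕ)) - α) := by
      intro q _
      have e : ∀ x : ZMod n, (cyclicIndicator n A x - α) *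
          (cyclicIndicator n A (x + (q ^ 2 : ℕ)) - α) =
          cyclicIndicator n A x * cyclicIndicator n A (x + (q ^ 2 : ℕ)) -
          α * cyclicIndicator n A (x + 0) - α * cyclicIndicator n A (x + (q ^ 2 : ℕ)) + α ^ 2 := by
        intro x
        rw [add_zero]
        ring
      rw [Finset.sum_congr rfl fun x _ => e x, Finset.sum_add_distrib, Finset.sum_sub_distrib,
        Finset.sum_sub_distrib, ← Finset.mul_sum, ← Finset.mul_sum, hmean, hmean]
      simp only [Finset.sum_const, Finset.card_univ, ZMod.card, nsmul_eq_mul]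
      ring
    rw [Finset.sum_congr rfl this, Finset.sum_add_distrib]
    simp only [Finset.sum_const, Finset.card_range, nsmul_eq_mul]
    ring
  have h4 : |∑ x : ZMod n, (cyclicIndicator n A x - α) *
        ∑ q ∈ Finset.range Q, (cyclicIndicator n A (x + (q ^ 2 : ℕ)) - α)| ≤
      ∑ x : ZMod n, |∑ q ∈ Finset.range Q, (cyclicIndicator n A (x + (q ^ 2 : ℕ)) - α)| := by
    refine (Finset.abs_sum_le_sum_abs _ _).trans (Finset.sum_le_sum fun x _ => ?_)
    rw [abs_mul]
    exact mul_le_of_le_one_left (abs_nonneg _) (hf x)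
  have h5 := (abs_le.1 h4).1
  linarith

end Cyclic

/-- **Sárközy's theorem**: a subset of `{0, …, L - 1}` of density at least `δ` contains two
elements that differ by a positive square, once `L` is chosen well in terms of `δ`. -/
theorem exists_not_squareDifferenceFree {δ : ℝ} (hδ : 0 < δ) :
    ∃ L : ℕ, 0 < L ∧ ∀ A ⊆ Finset.range L, δ * L ≤ A.card → ¬ SquareDifferenceFree A := by
  by_contra! hcon
  -- If the theorem fails for `δ`, every member of `S` is at least `δ`, so the infimum is positive.
  set S : Set ℝ := {s | ∃ L : ℕ, 0 < L ∧ ∀ B ⊆ Finset.range L, SquareDifferenceFree B →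
    (B.card : ℝ) ≤ s * L} with hS
  have hS0 : ∀ s ∈ S, δ ≤ s := by
    rintro s ⟨L, hL, h⟩
    obtain ⟨A, hA, hc, hf⟩ := hcon L hL
    have := hc.trans (h A hA hf)
    exact le_of_mul_le_mul_right this (by exact_mod_cast hL)
  have hS1 : (1 : ℝ) ∈ S := by
    refine ⟨1, one_pos, fun B hB _ => ?_⟩
    have := Finset.card_le_card hB
    rw [Finset.card_range] at this
    rw [one_mul]
    exact_mod_cast this
  have hbdd : BddBelow S := ⟨δ, hS0⟩
  set d : ℝ := sInf S with hd
  have hd0 : 0 < d := hδ.trans_le (le_csInf ⟨1, hS1⟩ hS0)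
  -- The parameters depend in turn on `d`, `H` and `ε`, `L`, `Q`, `n`. The terms under the root add
  -- up to at most `d ^ 4 / 16` after normalization, so the root costs `d ^ 2 / 4`; all errors
  -- together stay below the main term.
  obtain ⟨H, hHd⟩ := exists_nat_ge (64 / d ^ 4)
  have hH : 0 < H := by
    have : (0 : ℝ) < H := lt_of_lt_of_le (by positivity) hHd
    exact_mod_cast this
  set ε : ℝ := d ^ 4 / 256 with hε
  have hε0 : 0 < ε := by positivity
  obtain ⟨s, ⟨L, hL, hsL⟩, hs⟩ := exists_lt_of_csInf_lt ⟨1, hS1⟩ (by linarith : sInf S < d + ε)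
  obtain ⟨Q, hQd⟩ := exists_nat_ge
    ((1 + 2 * H) / (d ^ 2 / 4) + 4 * H * L / (d ^ 4 / 64) + 1 : ℝ)
  obtain ⟨n, hnd⟩ := exists_nat_ge
    ((Q ^ 2 + 1) / (d ^ 2 / 8) + 8 * H ^ 2 * L / (d ^ 4 / 128) + 1 / ε + 1 : ℝ)
  have p1 : (0 : ℝ) ≤ (1 + 2 * H) / (d ^ 2 / 4) := by positivity
  have p2 : (0 : ℝ) ≤ 4 * H * L / (d ^ 4 / 64) := by positivity
  have p3 : (0 : ℝ) ≤ (Q ^ 2 + 1) / (d ^ 2 / 8) := by positivity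
  have p4 : (0 : ℝ) ≤ 8 * H ^ 2 * L / (d ^ 4 / 128) := by positivity
  have p5 : (0 : ℝ) ≤ 1 / ε := by positivity
  have hQ : (0 : ℝ) < Q := by linarith
  have hn : (0 : ℝ) < n := by linarith
  have q1 : 1 + 2 * (H : ℝ) ≤ Q * (d ^ 2 / 4) := by
    rw [← div_le_iff₀ (by positivity)]; linarith
  have q2 : 4 * H * L ≤ Q * (d ^ 4 / 64) := by
    rw [← div_le_iff₀ (by positivity)]; linarith
  have q3 : (Q : ℝ) ^ 2 + 1 ≤ n * (d ^ 2 / 8) := by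
    rw [← div_le_iff₀ (by positivity)]; linarith
  have q4 : 8 * (H : ℝ) ^ 2 * L ≤ n * (d ^ 4 / 128) := by
    rw [← div_le_iff₀ (by positivity)]; linarith
  have q6 : (n : ℝ) / H ≤ n * (d ^ 4 / 64) := by
    rw [div_le_iff₀ (by exact_mod_cast hH), mul_assoc]
    refine le_mul_of_one_le_right hn.le ?_
    rw [div_le_iff₀ (by positivity)] at hHd
    linarith
  have hn' : 0 < n := by exact_mod_cast hn
  have : NeZero n := ⟨hn'.ne'⟩
  -- Without such a set, `d - ε` would lie in `S`, below its infimum.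
  obtain ⟨A, hAn, hAf, hAd⟩ : ∃ A ⊆ Finset.range n, SquareDifferenceFree A ∧
      (d - ε) * n < A.card := by
    by_contra! h
    have : d - ε ∈ S := ⟨n, hn', h⟩
    have := csInf_le hbdd this
    linarith
  set α : ℝ := (A.card : ℝ) / n with hα
  have hαd : d - ε ≤ α := by rw [hα, le_div_iff₀ hn]; exact hAd.le
  have hmain := hAf.density_le hAn Q hH hL (ε := 2 * ε) (by positivity) (by
    intro B hB hBf
    refine (hsL B hB hBf).trans (mul_le_mul_of_nonneg_right ?_ (Nat.cast_nonneg _))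
    linarith)
  rw [← hα] at hmain
  have hd1 : d ≤ 1 := csInf_le hbdd hS1
  have hsq : √((n : ℝ) * (Q * ((Q * n) / H + (4 * H * L * n +
      Q * (2 * (2 * ε) * n + 8 * H ^ 2 * L))))) ≤ Q * n * (d ^ 2 / 4) := by
    apply Real.sqrt_le_iff.2 ⟨by positivity, ?_⟩
    have e1 : (Q * n : ℝ) / H ≤ Q * n * (d ^ 4 / 64) := by
      rw [mul_div_assoc, mul_assoc]; exact mul_le_mul_of_nonneg_left q6 hQ.le
    have e2 : 4 * H * L * (n : ℝ) ≤ Q * n * (d ^ 4 / 64) := by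
      have := mul_le_mul_of_nonneg_right q2 hn.le
      linarith
    have e3 : Q * (2 * (2 * ε) * n + 8 * H ^ 2 * L) ≤ Q * n * (d ^ 4 / 64 + d ^ 4 / 128) := by
      have := mul_le_mul_of_nonneg_left q4 hQ.le
      rw [hε]
      linarith
    have e4 : (Q * n : ℝ) / H + (4 * H * L * n + Q * (2 * (2 * ε) * n + 8 * H ^ 2 * L)) ≤
        Q * n * (d ^ 4 / 16) := by
      have : 0 ≤ Q * n * (d ^ 4 / 128) := by positivity
      linarith
    calc _ ≤ (n : ℝ) * (Q * (Q * n * (d ^ 4 / 16))) := by gcongr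
      _ = _ := by ring
  have hα2 : d ^ 2 - d ^ 2 / 128 ≤ α ^ 2 := by
    have hd4 : d ^ 4 ≤ d := by
      calc d ^ 4 ≤ d ^ 1 := pow_le_pow_of_le_one hd0.le hd1 (by norm_num)
        _ = d := pow_one d
    have h0 : 0 ≤ d - ε := by rw [hε]; linarith
    have h1 := pow_le_pow_left₀ h0 hαd 2
    have h2 : d * ε ≤ d * (d / 256) := mul_le_mul_of_nonneg_left (by rw [hε]; linarith) hd0.le
    nlinarith [sq_nonneg ε]
  have r1 : (n : ℝ) + 2 * H * n ≤ Q * n * (d ^ 2 / 4) := by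
    have := mul_le_mul_of_nonneg_right q1 hn.le
    linarith
  have r2 : (Q : ℝ) * (Q ^ 2 + 1) ≤ Q * n * (d ^ 2 / 8) := by
    have := mul_le_mul_of_nonneg_left q3 hQ.le
    linarith
  have r3 : Q * n * (d ^ 2 - d ^ 2 / 128) ≤ Q * n * α ^ 2 :=
    mul_le_mul_of_nonneg_left hα2 (by positivity)
  have r4 : 0 < Q * n * d ^ 2 := by positivity
  linarith

/-! ### Popular translates of a pattern -/

section Patterns

variable {ι τ : Type*} [Fintype ι]

/-- The positions `x` for which a translate of a pattern in `{0, …, N}^ι` may meet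
`{1, …, N}^ι`. -/
noncomputable def translateBox (ι : Type*) [Fintype ι] [DecidableEq ι] (N : ℕ) : Finset (ι → ℤ) :=
  Fintype.piFinset fun _ => Finset.Ioc (-(N : ℤ)) N

open Classical in
/-- The elements `t` of the pattern `p` whose translate by `x` lies in `A`. -/
noncomputable def patternHits (A : Finset (ι → ℕ)) (T : Finset τ) (p : τ → ι → ℕ) (x : ι → ℤ) :
    Finset τ :=
  T.filter fun t => ∃ a ∈ A, ∀ i, (a i : ℤ) = x i + p t i

theorem mem_patternHits {A : Finset (ι → ℕ)} {T : Finset τ} {p : τ → ι → ℕ} {x : ι → ℤ} {t : τ} :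
    t ∈ patternHits A T p x ↔ t ∈ T ∧ ∃ a ∈ A, ∀ i, (a i : ℤ) = x i + p t i := by
  simp [patternHits]

theorem patternHits_subset (A : Finset (ι → ℕ)) (T : Finset τ) (p : τ → ι → ℕ) (x : ι → ℤ) :
    patternHits A T p x ⊆ T :=
  Finset.filter_subset _ _

variable [DecidableEq ι]

/-- Double counting: for fixed `t`, the translates placing the point `t` in `A` correspond to the
elements of `A`, and all of them lie in the box. -/
theorem sum_card_patternHits {N : ℕ} {A : Finset (ι → ℕ)}
    (hA : A ⊆ Fintype.piFinset fun _ => interval N) {T : Finset τ} {p : τ → ι → ℕ}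
    (hp : ∀ t ∈ T, ∀ i, p t i ≤ N) :
    ∑ x ∈ translateBox ι N, (patternHits A T p x).card = A.card * T.card := by
  classical
  simp only [patternHits, Finset.card_filter]
  rw [Finset.sum_comm]
  have key : ∀ t ∈ T, ∑ x ∈ translateBox ι N,
      (if ∃ a ∈ A, ∀ i, (a i : ℤ) = x i + p t i then 1 else 0) = A.card := by
    intro t ht
    rw [← Finset.card_filter]
    symm
    refine Finset.card_bij (fun a _ i => (a i : ℤ) - p t i) ?_ ?_ ?_
    · intro a ha
      have h := Fintype.mem_piFinset.1 (hA ha)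
      refine Finset.mem_filter.2 ⟨Fintype.mem_piFinset.2 fun i => ?_, a, ha, fun i => by ring⟩
      have h1 := Finset.mem_Icc.1 (h i)
      have h2 := hp t ht i
      rw [Finset.mem_Ioc]
      omega
    · intro a _ b _ h
      funext i
      have := congrFun h i
      omega
    · intro x hx
      obtain ⟨-, a, ha, h⟩ := Finset.mem_filter.1 hx
      refine ⟨a, ha, ?_⟩
      funext i
      have := h i
      omega
  rw [Finset.sum_congr rfl key, Finset.sum_const, smul_eq_mul, mul_comm]

-- The threshold is half the guaranteed mean number of hits over the `(2N)^|ι|` translates, so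
-- unpopular translates account for at most half of the total.
open Classical in
theorem le_card_popular_translates {N : ℕ} {A : Finset (ι → ℕ)}
    (hA : A ⊆ Fintype.piFinset fun _ => interval N) {T : Finset τ} (hT : T.Nonempty)
    {p : τ → ι → ℕ} (hp : ∀ t ∈ T, ∀ i, p t i ≤ N) {δ : ℝ} (hδ : 0 < δ)
    (hcard : δ * (N : ℝ) ^ Fintype.card ι ≤ A.card) :
    δ / 2 * (N : ℝ) ^ Fintype.card ι ≤ ((translateBox ι N).filter fun x =>
      δ / 2 ^ (Fintype.card ι + 1) * T.card ≤ ((patternHits A T p x).card : ℝ)).card := by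
  set η : ℝ := δ / 2 ^ (Fintype.card ι + 1) with hη
  have hT' : (0 : ℝ) < T.card := by exact_mod_cast hT.card_pos
  have h1 : ∀ x ∈ translateBox ι N, ((patternHits A T p x).card : ℝ) ≤
      (if η * T.card ≤ ((patternHits A T p x).card : ℝ) then (T.card : ℝ) else 0) +
        η * T.card := by
    intro x _
    split_ifs with h
    · have : ((patternHits A T p x).card : ℝ) ≤ T.card := by
        exact_mod_cast Finset.card_le_card (Finset.filter_subset _ _)
      have : 0 ≤ η * T.card := by positivity
      linarith
    · linarith
  have h2 := Finset.sum_le_sum h1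
  have h3 : ∑ x ∈ translateBox ι N, ((patternHits A T p x).card : ℝ) = A.card * T.card := by
    exact_mod_cast sum_card_patternHits hA hp
  have h4 : ((translateBox ι N).card : ℝ) = 2 ^ Fintype.card ι * (N : ℝ) ^ Fintype.card ι := by
    rw [translateBox, Fintype.card_piFinset]
    simp only [Int.card_Ioc, Finset.prod_const, Finset.card_univ]
    have : ((N : ℤ) - -(N : ℤ)).toNat = 2 * N := by omega
    rw [this]
    push_cast
    rw [mul_pow]
  rw [h3, Finset.sum_add_distrib, ← Finset.sum_filter, Finset.sum_const, Finset.sum_const,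
    nsmul_eq_mul, nsmul_eq_mul, h4, ← mul_assoc, ← add_mul] at h2
  have h5 := le_of_mul_le_mul_right h2 hT'
  have h6 : 2 ^ Fintype.card ι * (N : ℝ) ^ Fintype.card ι * η =
      δ / 2 * (N : ℝ) ^ Fintype.card ι := by
    rw [hη, pow_succ]
    field_simp
  rw [h6] at h5
  linarith

end Patterns

/-! ### Common square differences through a power of the set -/

/-- A dense set of lattice points contains all the differences `q² (m₁², …, m_d²)` with
`1 ≤ m_i ≤ M`, for a common `q`. -/
theorem exists_simultaneous_square_differences {δ : ℝ} (hδ : 0 < δ) (d : ℕ) {M : ℕ} (hM : 0 < M) :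
    ∃ N : ℕ, 0 < N ∧ ∀ A ⊆ grid d N, δ * (N : ℝ) ^ d ≤ A.card →
      ∃ q : ℕ, 0 < q ∧ ∀ m : Fin d → ℕ, (∀ i, m i ∈ interval M) →
        ∃ a ∈ A, ∃ a' ∈ A, ∀ i, a i = a' i + (q * m i) ^ 2 := by
  classical
  set κ := Fin d → Fin M with hκ
  set D := Fintype.card (κ × Fin d) with hD
  have hD' : D = d * Fintype.card κ := by rw [hD, Fintype.card_prod, Fintype.card_fin, mul_comm]
  -- The density of the power `A ^ κ`, less the loss from choosing a popular translate in dimension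
  -- `D`.
  obtain ⟨L, hL, hS⟩ := exists_not_squareDifferenceFree
    (δ := δ ^ Fintype.card κ / 2 ^ (D + 1)) (by positivity)
  have hN : 0 < L * M ^ 2 := by positivity
  refine ⟨L * M ^ 2, hN, fun A hA hcard => ?_⟩
  set P : Finset (κ × Fin d → ℕ) := (Fintype.piFinset fun _ : κ => A).map
    (Equiv.curry κ (Fin d) ℕ).symm.toEmbedding with hP
  have hPmem : ∀ z ∈ P, ∀ m : κ, (fun i => z (m, i)) ∈ A := by
    intro z hz m
    obtain ⟨y, hy, rfl⟩ := Finset.mem_map.1 hz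
    exact Fintype.mem_piFinset.1 hy m
  have hPN : P ⊆ Fintype.piFinset fun _ => interval (L * M ^ 2) := fun z hz =>
    Fintype.mem_piFinset.2 fun mi => Fintype.mem_piFinset.1 (hA (hPmem z hz mi.1)) mi.2
  have hPcard : δ ^ Fintype.card κ * ((L * M ^ 2 : ℕ) : ℝ) ^ Fintype.card (κ × Fin d) ≤
      P.card := by
    rw [hP, Finset.card_map, Fintype.card_piFinset, Finset.prod_const, Finset.card_univ,
      ← hD, hD', pow_mul, ← mul_pow]
    push_cast at hcard ⊢
    exact pow_le_pow_left₀ (by positivity) hcard _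
  -- A line whose block `m` points along the squares of the entries of `m`, shifted from `Fin M` to
  -- `[M]`. A square difference `q ^ 2` in `l` thus serves every `m` at once.
  set p : ℕ → κ × Fin d → ℕ := fun l mi => l * ((mi.1 mi.2 : ℕ) + 1) ^ 2 with hp
  have hpN : ∀ l ∈ Finset.range L, ∀ i, p l i ≤ L * M ^ 2 := fun l hl i =>
    Nat.mul_le_mul (Finset.mem_range.1 hl).le (Nat.pow_le_pow_left (i.1 i.2).2 2)
  have hpop := le_card_popular_translates hPN (Finset.nonempty_range_iff.2 hL.ne') hpN
    (by positivity) hPcard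
  have hpos : (0 : ℝ) < δ ^ Fintype.card κ / 2 *
      ((L * M ^ 2 : ℕ) : ℝ) ^ Fintype.card (κ × Fin d) := by
    have : (0 : ℝ) < ((L * M ^ 2 : ℕ) : ℝ) := by exact_mod_cast hN
    positivity
  obtain ⟨x, hx⟩ := Finset.card_pos.1 (Nat.cast_pos.1 (hpos.trans_le hpop))
  rw [Finset.mem_filter, Finset.card_range] at hx
  have hnot := hS _ (patternHits_subset P (Finset.range L) p x) hx.2
  unfold SquareDifferenceFree at hnot
  push Not at hnot
  obtain ⟨l, hl, q, hq, hl'⟩ := hnot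
  obtain ⟨-, z', hz', hzx'⟩ := mem_patternHits.1 hl
  obtain ⟨-, z, hz, hzx⟩ := mem_patternHits.1 hl'
  refine ⟨q, hq, fun m hm => ?_⟩
  have hm' : ∀ i, 1 ≤ m i ∧ m i ≤ M := fun i => Finset.mem_Icc.1 (hm i)
  set μ : κ := fun i => ⟨m i - 1, by have := hm' i; omega⟩ with hμ
  refine ⟨_, hPmem z hz μ, _, hPmem z' hz' μ, fun i => ?_⟩
  have e1 := hzx (μ, i)
  have e2 := hzx' (μ, i)
  have e3 : m i - 1 + 1 = m i := by have := hm' i; omega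
  simp only [hp, hμ, e3] at e1 e2
  zify
  rw [e1, e2]
  push_cast
  ring

/-! ### Counting solutions in stretched grids -/

/-- The solution set of the multidimensional problem has the size that a count of rescaled
copies of the grid `[N₁]^d` predicts. -/
theorem exists_le_card_multiSarkozySolutions {δ : ℝ} (hδ : 0 < δ) (d : ℕ) {M : ℕ} (hM : 0 < M) :
    ∃ N₁ : ℕ, 0 < N₁ ∧ ∀ N R : ℕ, R ^ 2 * N₁ ≤ N →
      ∀ (A : Finset (Fin d → ℕ)) (B : Fin d → Set ℕ),
        A ⊆ grid d N → δ * (N : ℝ) ^ d ≤ (A.card : ℝ) → (∀ i, IsHomogeneousSet M (B i)) →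
          δ / 2 * (N : ℝ) ^ d * (R : ℝ) ^ d ≤
            (multiSarkozySolutions A B).ncard * ((N₁ : ℝ) ^ d * (N₁ : ℝ) ^ d) := by
  classical
  obtain ⟨N₁, hN₁, hsim⟩ := exists_simultaneous_square_differences
    (δ := δ / 2 ^ (d + 1)) (by positivity) d hM
  refine ⟨N₁, hN₁, fun N R hR A B hA hcard hB => ?_⟩
  set p : (Fin d → ℕ) → (Fin d → ℕ) → Fin d → ℕ := fun r u i => r i ^ 2 * u i with hp
  set good : (Fin d → ℕ) → Finset (Fin d → ℤ) := fun r => (translateBox (Fin d) N).filter fun x =>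
    δ / 2 ^ (d + 1) * (grid d N₁).card ≤ ((patternHits A (grid d N₁) (p r) x).card : ℝ) with hgood
  have hgrid : ∀ K : ℕ, (grid d K).card = K ^ d := fun K => by
    simp [grid, interval]
  have hne : (grid d N₁).Nonempty := by
    rw [← Finset.card_pos, hgrid]; positivity
  have hpop : ∀ r ∈ grid d R, δ / 2 * (N : ℝ) ^ d ≤ (good r).card := by
    intro r hr
    have hpN : ∀ u ∈ grid d N₁, ∀ i, p r u i ≤ N := by
      intro u hu i
      have h1 := (Finset.mem_Icc.1 (Fintype.mem_piFinset.1 hr i)).2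
      have h2 := (Finset.mem_Icc.1 (Fintype.mem_piFinset.1 hu i)).2
      exact (Nat.mul_le_mul (Nat.pow_le_pow_left h1 2) h2).trans hR
    have := le_card_popular_translates hA hne hpN hδ (by rwa [Fintype.card_fin])
    simpa only [Fintype.card_fin] using this
  set sol := (multiSarkozySolutions_finite A B).toFinset with hsol
  have hle : ((grid d R).sigma good).card ≤ (sol ×ˢ (grid d N₁ ×ˢ grid d N₁)).card := by
    -- A stretch and a position `(r, x)` are matched with a solution labelled by `u` and `w = q m`.
    -- The label determines `r` from `y_i = r_i w_i`, and hence `x`.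
    refine Finset.card_le_card_of_forall_subsingleton
      (fun g b => ∀ i, g.1 i * b.2.2 i = b.1.2.2 i ∧
        (b.1.1 i : ℤ) = g.2 i + (g.1 i : ℤ) ^ 2 * b.2.1 i) ?_ ?_
    · rintro ⟨r, x⟩ hg
      obtain ⟨hr, hx⟩ := Finset.mem_sigma.1 hg
      dsimp only at hr hx
      obtain ⟨q, hq, hdiff⟩ := hsim _ (patternHits_subset A _ (p r) x)
        (by simpa only [hgrid, Nat.cast_pow] using (Finset.mem_filter.1 hx).2)
      have hr' : ∀ i, 0 < r i := fun i => (Finset.mem_Icc.1 (Fintype.mem_piFinset.1 hr i)).1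
      -- A difference `(q m_i)²` in the grid becomes `(q r_i m_i)²` after stretching, so homogeneity
      -- is used at `q * r i`.
      have hm : ∀ i, ∃ m ∈ interval M, q * r i * m ∈ B i := by
        intro i
        obtain ⟨b, hb, m, hm, hbm⟩ := (hB i).2 (q * r i) (Nat.mul_pos hq (hr' i))
        dsimp only at hbm
        exact ⟨m, hm, by rwa [hbm]⟩
      choose m hm hmB using hm
      obtain ⟨u, hu, u', hu', huu⟩ := hdiff m hm
      obtain ⟨huN, a, ha, hax⟩ := mem_patternHits.1 hu
      obtain ⟨-, a', ha', hax'⟩ := mem_patternHits.1 hu'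
      refine ⟨((a, a', fun i => q * r i * m i), u, fun i => q * m i), ?_, ?_⟩
      · refine Finset.mem_product.2 ⟨?_, Finset.mem_product.2 ⟨huN, ?_⟩⟩
        · rw [hsol, Set.Finite.mem_toFinset]
          refine ⟨ha, ha', hmB, fun i => ?_⟩
          dsimp only
          rw [hax, hax', hp]
          dsimp only
          rw [huu]
          push_cast
          ring
        · refine Fintype.mem_piFinset.2 fun i => Finset.mem_Icc.2 ⟨?_, ?_⟩
          · exact Nat.mul_pos hq (Finset.mem_Icc.1 (hm i)).1
          · have h1 := (Finset.mem_Icc.1 (Fintype.mem_piFinset.1 huN i)).2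
            have h2 := huu i
            have h3 := Nat.le_self_pow two_ne_zero (q * m i)
            dsimp only
            omega
      · intro i
        refine ⟨by dsimp only; ring, ?_⟩
        dsimp only
        rw [hax, hp]
        push_cast
        ring
    · rintro ⟨s, u, w⟩ hb ⟨r, x⟩ ⟨-, h⟩ ⟨r', x'⟩ ⟨-, h'⟩
      have hw := (Finset.mem_product.1 (Finset.mem_product.1 hb).2).2
      dsimp only at h h' hw
      have hrr : r = r' := by
        funext i
        have h1 := (Finset.mem_Icc.1 (Fintype.mem_piFinset.1 hw i)).1
        exact Nat.eq_of_mul_eq_mul_right h1 ((h i).1.trans (h' i).1.symm)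
      subst hrr
      have hxx : x = x' := by
        funext i
        linarith [(h i).2, (h' i).2]
      rw [hxx]
  rw [Finset.card_sigma, Finset.card_product, Finset.card_product, hgrid, hsol,
    ← Set.ncard_eq_toFinset_card _ (multiSarkozySolutions_finite A B)] at hle
  have h1 : ((R : ℝ) ^ d) * (δ / 2 * (N : ℝ) ^ d) ≤ ∑ r ∈ grid d R, ((good r).card : ℝ) := by
    have := Finset.card_nsmul_le_sum (grid d R) (fun r => ((good r).card : ℝ)) _ hpop
    rwa [hgrid, nsmul_eq_mul, Nat.cast_pow] at this
  have h2 : ∑ r ∈ grid d R, ((good r).card : ℝ) ≤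
      (multiSarkozySolutions A B).ncard * ((N₁ : ℝ) ^ d * (N₁ : ℝ) ^ d) := by exact_mod_cast hle
  linarith

theorem multidimensional_supersaturation {δ : ℝ} (hδ : 0 < δ) (d : ℕ) {M : ℕ} (hM : 0 < M) :
    ∃ (N₀ : ℕ) (c₀ : ℝ), 0 < c₀ ∧ ∀ N : ℕ, N₀ ≤ N →
      ∀ (A : Finset (Fin d → ℕ)) (B : Fin d → Set ℕ),
        A ⊆ grid d N → δ * (N : ℝ) ^ d ≤ (A.card : ℝ) → (∀ i, IsHomogeneousSet M (B i)) →
          c₀ * (N : ℝ) ^ (3 * (d : ℝ) / 2) ≤ ((multiSarkozySolutions A B).ncard : ℝ) := by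
  obtain ⟨N₁, hN₁, h⟩ := exists_le_card_multiSarkozySolutions hδ d hM
  have hN₁' : (0 : ℝ) < N₁ := by exact_mod_cast hN₁
  refine ⟨N₁, δ / 2 * (1 / (2 * √N₁)) ^ d / ((N₁ : ℝ) ^ d * (N₁ : ℝ) ^ d), by positivity,
    fun N hN A B hA hcard hB => ?_⟩
  -- The largest stretch allowed. Since `R ≥ 1`, `R + 1 ≤ 2 * R`, so `R` is at least a constant
  -- times `√N`.
  set R := Nat.sqrt (N / N₁) with hR
  have hR1 : R ^ 2 * N₁ ≤ N :=
    (Nat.mul_le_mul_right _ (Nat.sqrt_le' _)).trans (Nat.div_mul_le_self _ _)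
  have hR2 : 0 < R := Nat.sqrt_pos.2 (Nat.div_pos hN hN₁)
  have hR3 : N < (R + 1) ^ 2 * N₁ :=
    (Nat.div_lt_iff_lt_mul hN₁).1 (Nat.lt_succ_sqrt' (N / N₁))
  have hR4 : √(N : ℝ) ≤ R * (2 * √N₁) := by
    rw [Real.sqrt_le_iff]
    refine ⟨by positivity, ?_⟩
    rw [mul_pow, mul_pow, Real.sq_sqrt hN₁'.le]
    have h1 : (N : ℝ) ≤ ((R : ℝ) + 1) ^ 2 * N₁ := by exact_mod_cast hR3.le
    have h2 : (1 : ℝ) ≤ R := by exact_mod_cast hR2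
    have h3 : ((R : ℝ) + 1) ^ 2 ≤ (2 * R) ^ 2 := pow_le_pow_left₀ (by positivity) (by linarith) 2
    have h4 := mul_le_mul_of_nonneg_right h3 hN₁'.le
    linarith
  have hpow : (N : ℝ) ^ (3 * (d : ℝ) / 2) = (N : ℝ) ^ d * √(N : ℝ) ^ d := by
    have hNpos : (0 : ℝ) < N := by exact_mod_cast hN₁.trans_le hN
    rw [Real.sqrt_eq_rpow, ← Real.rpow_natCast, ← Real.rpow_natCast, ← Real.rpow_mul hNpos.le,
      ← Real.rpow_add hNpos]
    congr 1
    ring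
  have hmain := h N R hR1 A B hA hcard hB
  rw [hpow, div_mul_eq_mul_div, div_le_iff₀ (by positivity)]
  refine le_trans ?_ hmain
  have h5 : √(N : ℝ) ^ d * (1 / (2 * √N₁)) ^ d ≤ (R : ℝ) ^ d := by
    rw [← mul_pow]
    refine pow_le_pow_left₀ (by positivity) ?_ d
    rw [mul_one_div, div_le_iff₀ (by positivity)]
    exact hR4
  have h6 := mul_le_mul_of_nonneg_left h5 (by positivity : 0 ≤ δ / 2 * (N : ℝ) ^ d)
  linarith

/-! ### Reduction of the three-squares equation to dimension three -/

/-- The points of `[N]³` whose sum of coordinates lies in `A`. -/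
def sumPreimage (N : ℕ) (A : Finset ℕ) : Finset (Fin 3 → ℕ) :=
  (grid 3 N).filter fun z => z 0 + z 1 + z 2 ∈ A

/-- For `a ∈ A` above `2 * K`, two coordinates can be chosen freely in `[K]` and the third remains
positive. -/
theorem card_sumPreimage_ge {N : ℕ} {A : Finset ℕ} (hA : A ⊆ interval N) {K : ℕ} :
    ((A.card : ℝ) - 2 * K) * K ^ 2 ≤ (sumPreimage N A).card := by
  classical
  set big := A.filter fun a => 2 * K < a with hbig
  have h1 : A.card ≤ big.card + 2 * K := by
    have h := Finset.card_filter_add_card_filter_not (s := A) (fun a => 2 * K < a)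
    have h2 : (A.filter fun a => ¬ 2 * K < a).card ≤ (Finset.Icc 1 (2 * K)).card := by
      refine Finset.card_le_card fun a ha => ?_
      obtain ⟨ha, ha'⟩ := Finset.mem_filter.1 ha
      have := Finset.mem_Icc.1 (hA ha)
      rw [Finset.mem_Icc]
      omega
    rw [Nat.card_Icc] at h2
    rw [hbig]
    omega
  have h3 : (big ×ˢ (interval K ×ˢ interval K)).card ≤ (sumPreimage N A).card := by
    refine Finset.card_le_card_of_injOn (fun t => ![t.2.1, t.2.2, t.1 - t.2.1 - t.2.2]) ?_ ?_
    · rintro ⟨a, s, t⟩ h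
      simp only [Finset.coe_product, Set.mem_prod, Finset.mem_coe, hbig, Finset.mem_filter,
        interval, Finset.mem_Icc] at h
      obtain ⟨⟨ha, haK⟩, hs, ht⟩ := h
      have haN := Finset.mem_Icc.1 (hA ha)
      refine Finset.mem_coe.2 (Finset.mem_filter.2 ⟨Fintype.mem_piFinset.2 fun i => ?_, ?_⟩)
      · rw [interval, Finset.mem_Icc]
        fin_cases i <;> simp <;> omega
      · have : s + t + (a - s - t) = a := by omega
        simpa [this] using ha
    · rintro ⟨a, s, t⟩ h ⟨a', s', t'⟩ h' e
      simp only [Finset.coe_product, Set.mem_prod, Finset.mem_coe, hbig, Finset.mem_filter,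
        interval, Finset.mem_Icc] at h h'
      have e0 := congrFun e 0
      have e1 := congrFun e 1
      have e2 := congrFun e 2
      simp at e0 e1 e2
      simp only [Prod.mk.injEq]
      omega
  rw [Finset.card_product, Finset.card_product] at h3
  simp only [interval, Nat.card_Icc, Nat.add_sub_cancel] at h3
  have h4 : (A.card : ℝ) - 2 * K ≤ big.card := by
    have : (A.card : ℝ) ≤ big.card + 2 * K := by exact_mod_cast h1
    linarith
  have h5 := mul_le_mul_of_nonneg_right h4 (by positivity : (0 : ℝ) ≤ (K : ℝ) ^ 2)
  have h6 : (big.card : ℝ) * (K * K) ≤ (sumPreimage N A).card := by exact_mod_cast h3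
  linarith

/-- Over a given solution, the coordinates `z 0` and `z 1` determine `z` through its sum, and `z'`
follows from `y`. -/
theorem ncard_multiSarkozySolutions_sumPreimage_le (N : ℕ) (A : Finset ℕ) (B : Set ℕ) :
    (multiSarkozySolutions (sumPreimage N A) fun _ => B).ncard ≤
      (sarkozySolutions A B).ncard * (N * N) := by
  classical
  rw [Set.ncard_eq_toFinset_card _ (multiSarkozySolutions_finite _ _),
    Set.ncard_eq_toFinset_card _ (sarkozySolutions_finite A B)]
  have hN : N * N = (interval N ×ˢ interval N).card := by
    rw [Finset.card_product]; simp [interval]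
  rw [hN, ← Finset.card_product]
  refine Finset.card_le_card_of_injOn
    (fun s => ((![s.1 0 + s.1 1 + s.1 2, s.2.1 0 + s.2.1 1 + s.2.1 2], s.2.2), s.1 0, s.1 1)) ?_ ?_
  · rintro ⟨z, z', y⟩ h
    obtain ⟨hz, hz', hy, hzy⟩ := (Set.Finite.mem_toFinset _).1 (Finset.mem_coe.1 h)
    dsimp only at hz hz' hy hzy
    obtain ⟨hzg, hzA⟩ := Finset.mem_filter.1 hz
    obtain ⟨-, hzA'⟩ := Finset.mem_filter.1 hz'
    refine Finset.mem_coe.2 (Finset.mem_product.2 ⟨?_, Finset.mem_product.2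
      ⟨Fintype.mem_piFinset.1 hzg 0, Fintype.mem_piFinset.1 hzg 1⟩⟩)
    rw [Set.Finite.mem_toFinset]
    refine ⟨fun i => ?_, hy, ?_⟩
    · fin_cases i
      · exact hzA
      · exact hzA'
    · simp only [Matrix.cons_val_zero, Matrix.cons_val_one]
      rw [← hzy 0, ← hzy 1, ← hzy 2]
      push_cast
      ring
  · rintro ⟨z, z', y⟩ h ⟨w, w', v⟩ h' e
    obtain ⟨-, -, -, hzy⟩ := (Set.Finite.mem_toFinset _).1 (Finset.mem_coe.1 h)
    obtain ⟨-, -, -, hwv⟩ := (Set.Finite.mem_toFinset _).1 (Finset.mem_coe.1 h')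
    simp only [Prod.mk.injEq] at e hzy hwv
    obtain ⟨⟨es, rfl⟩, e0, e1⟩ := e
    have es0 := congrFun es 0
    simp only [Matrix.cons_val_zero] at es0
    have hzw : z = w := by
      funext i
      fin_cases i
      · exact e0
      · exact e1
      · show z 2 = w 2
        omega
    subst hzw
    have hzw' : z' = w' := by
      funext i
      have h1 := hzy i
      have h2 := hwv i
      omega
    rw [hzw']

theorem sarkozy_supersaturation {δ : ℝ} (hδ : 0 < δ) {M : ℕ} (hM : 0 < M) :
    ∃ (N₀ : ℕ) (c₀ : ℝ), 0 < c₀ ∧ ∀ N : ℕ, N₀ ≤ N → ∀ (A : Finset ℕ) (B : Set ℕ),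
      A ⊆ interval N → δ * (N : ℝ) ≤ (A.card : ℝ) → IsHomogeneousSet M B →
        c₀ * (N : ℝ) ^ (5 / 2 : ℝ) ≤ ((sarkozySolutions A B).ncard : ℝ) := by
  obtain ⟨N₀, c₀, hc₀, h⟩ := multidimensional_supersaturation
    (δ := δ / 2 * (δ / 16) ^ 2) (by positivity) 3 hM
  obtain ⟨N₂, hN₂⟩ := exists_nat_ge (16 / δ)
  refine ⟨max N₀ (max N₂ 1), c₀, hc₀, fun N hN A B hA hcard hB => ?_⟩
  simp only [max_le_iff] at hN
  obtain ⟨hN0, hN2, hN1⟩ := hN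
  have hNpos : (0 : ℝ) < N := by exact_mod_cast hN1
  have hδN : 16 ≤ δ * N := by
    have : 16 / δ ≤ N := hN₂.trans (by exact_mod_cast hN2)
    rw [div_le_iff₀ hδ] at this
    linarith
  -- Discarding `2 * K ≤ δ * N / 4` elements keeps over half of `A`, while `δ * N ≥ 16` ensures `K ≥
  -- δ * N / 16`.
  set K := ⌊δ * N / 8⌋₊ with hK
  have hK1 : (K : ℝ) ≤ δ * N / 8 := Nat.floor_le (by positivity)
  have hK2 : δ * N / 16 ≤ K := by
    have := Nat.lt_floor_add_one (δ * N / 8)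
    linarith
  have hdense : δ / 2 * (δ / 16) ^ 2 * (N : ℝ) ^ 3 ≤ (sumPreimage N A).card := by
    refine le_trans ?_ (card_sumPreimage_ge hA (K := K))
    have h1 : δ * N / 2 ≤ (A.card : ℝ) - 2 * K := by linarith
    have h2 : (δ * N / 16) ^ 2 ≤ (K : ℝ) ^ 2 := pow_le_pow_left₀ (by positivity) hK2 2
    have h3 := mul_le_mul h1 h2 (by positivity) (by linarith)
    linarith
  have h1 := h N hN0 (sumPreimage N A) (fun _ => B) (Finset.filter_subset _ _) hdense fun _ => hB
  have h2 : ((multiSarkozySolutions (sumPreimage N A) fun _ => B).ncard : ℝ) ≤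
      (sarkozySolutions A B).ncard * (N * N) := by
    exact_mod_cast ncard_multiSarkozySolutions_sumPreimage_le N A B
  have hpow : (N : ℝ) ^ (3 * ((3 : ℕ) : ℝ) / 2) = (N : ℝ) ^ (5 / 2 : ℝ) * (N * N) := by
    rw [← sq, ← Real.rpow_natCast, ← Real.rpow_add hNpos]
    norm_num
  rw [hpow, ← mul_assoc] at h1
  exact le_of_mul_le_mul_right (h1.trans h2) (by positivity)

theorem mainTheorem8 :
    (∀ (δ : ℝ) (M : ℕ), 0 < δ → 0 < M →
      ∃ (N₀ : ℕ) (c₀ : ℝ), 0 < c₀ ∧ ∀ N : ℕ, N₀ ≤ N →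
        ∀ (A : Finset ℕ) (B : Set ℕ),
          A ⊆ interval N → δ * (N : ℝ) ≤ (A.card : ℝ) → IsHomogeneousSet M B →
            c₀ * (N : ℝ) ^ (5 / 2 : ℝ) ≤ ((sarkozySolutions A B).ncard : ℝ)) ∧
    (∀ (δ : ℝ) (d M : ℕ), 0 < δ → 0 < d → 0 < M →
      ∃ (N₀ : ℕ) (c₀ : ℝ), 0 < c₀ ∧ ∀ N : ℕ, N₀ ≤ N →
        ∀ (A : Finset (Fin d → ℕ)) (B : Fin d → Set ℕ),
          A ⊆ grid d N → δ * (N : ℝ) ^ d ≤ (A.card : ℝ) → (∀ i, IsHomogeneousSet M (B i)) →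
            c₀ * (N : ℝ) ^ (3 * (d : ℝ) / 2) ≤ ((multiSarkozySolutions A B).ncard : ℝ)) :=
  ⟨fun _ _ hδ hM => sarkozy_supersaturation hδ hM,
    fun _ d _ hδ _ hM => multidimensional_supersaturation hδ d hM⟩
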